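/- Let $\Bbbk$ be an algebraically closed field of characteristic $0$, $V$ a finite-dimensional vector space with basis $x_1,\dots,x_n$, and $A=T(V)/(R)$, $R\subset V\otimes V$, a quadratic algebra which is Koszul, i.e. the right module $\Bbbk_A=A/A_{\ge 1}$ has a linear resolution $$\cdots\to A(-i)^{\oplus s_i}\xrightarrow{d_i}\cdots\to A(-2)^{\oplus s_2}\xrightarrow{d_2}A(-1)^{\oplus s_1}\xrightarrow{d_1}A\to\Bbbk_A\to 0 ;$$ let $h_i$ be the differentials of a linear resolution $\cdots\to A(-2)^{\oplus s'_2}\xrightarrow{h_2}A(-1)^{\oplus s'_1}\xrightarrow{h_1}A\to{}_A\Bbbk\to0$ of the left module ${}_A\Bbbk$. The $d_i$ and $h_i$ are matrices with entries in $V=A_1$; for $p=(p_1:\dots:p_n)\in\mathbb P(V^*)=\mathbb P^{n-1}$ and a matrix $M$ over $V$, let $M_p$ be the matrix over $\Bbbk$ obtained by substituting $x_a\mapsto p_a$. Let $X_A,\ {}_AX\subset\mathbb P(V^*)$ be the common zero loci of the $n\times n$ minors of $d_2$, respectively of $h_2$. Assume that $A$ is semi-standard, i.e. $X_A={}_AX$,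 and point-exact up to degree $2$, i.e. for $i=1,2$ $$\operatorname{rank}(d_i)_p+\operatorname{rank}(d_{i+1})_p=s_i\ \text{ for all }p\in X_A,\qquad \operatorname{rank}(h_i)_p+\operatorname{rank}(h_{i+1})_p=s'_i\ \text{ for all }p\in{}_AX .$$ Let $f\in A_2$ be regular ($af=0$ or $fa=0$ implies $a=0$) and normal ($Af=fA$), and let $B=A/(f)$. A quadratic algebra $T(V)/(R)$ satisfies (G1), with geometric pair $(E,\sigma)$, if $E\subset\mathbb P(V^*)$ is a projective variety (a Zariski closed subset, not necessarily irreducible, possibly empty) and $\sigma$ is an automorphism of the variety $E$ such that $$\{(p,q)\in\mathbb P(V^*)\times\mathbb P(V^*)\mid g(p,q)=0\ \ \forall g\in R\}=\{(p,\sigma(p))\mid p\in E\}.$$ Then $A$ satisfies (G1), and $B$ is a quadratic algebra, on the same generating space $V$, which satisfies (G1). Moreover, if $(E,\sigma)$ and $(E_B,\sigma_B)$ are geometric pairs of $A$ and of $B$, then $E_B\subset E$ and $\sigma_B=\sigma|_{E_B}$. -/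

import Mathlib

open scoped LinearAlgebra.Projectivization

noncomputable section

namespace KoszulPoint

/-! ## Projective space and its closed subvarieties

`V` is the `n`-dimensional space with basis `x_1, …, x_n`, and the projective space of `V^*` is
`ℙ k (Fin n → k)`: the point `(p_1 : … : p_n)` is the class of the functional `x_i ↦ p_i`. -/

section Projective

variable {k : Type*} [Field k] {n : ℕ}

/-- Common zeros in projective space of a set of polynomials. It is only used for homogeneous
polynomials, for which the choice of the representative `p.rep` does not matter. -/
def zeroLocus (S : Set (MvPolynomial (Fin n) k)) : Set (ℙ k (Fin n → k)) :=
  {p | ∀ g ∈ S, MvPolynomial.eval p.rep g = 0}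

/-- Projective varieties in projective space: the zero loci of sets of homogeneous polynomials.
Neither irreducibility nor non-emptiness is required. -/
def IsProjectiveVariety (E : Set (ℙ k (Fin n → k))) : Prop :=
  ∃ S : Set (MvPolynomial (Fin n) k), (∀ g ∈ S, ∃ m, g.IsHomogeneous m) ∧ E = zeroLocus S

/-- A map `φ : E → E` is a morphism of varieties: around every point `p` of `E` it has the form
`q ↦ (g_1(q) : … : g_n(q))` with homogeneous polynomials `g_j` of one degree `m` which do not all
vanish at `p`. (Multiplying all `g_j` by a form which is nonzero at `p` shrinks the open set on
which the `g_j` do not all vanish, so it is no restriction to use that whole open set.) -/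
def IsRegularMap {E : Set (ℙ k (Fin n → k))} (φ : E → E) : Prop :=
  ∀ p : E, ∃ (m : ℕ) (g : Fin n → MvPolynomial (Fin n) k),
    (∀ j, (g j).IsHomogeneous m) ∧
    (fun j => MvPolynomial.eval p.1.rep (g j)) ≠ 0 ∧
    ∀ (q : E) (hq : (fun j => MvPolynomial.eval q.1.rep (g j)) ≠ 0),
      (φ q : ℙ k (Fin n → k)) = Projectivization.mk k _ hq

end Projective

/-! ## Matrices over `V` -/

section LinMat

/-- `s × r` matrices with entries in `V`; the entry `∑ a, c a • x_a` is stored as the coefficient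
vector `c`. -/
abbrev LinMat (k : Type*) (n s r : ℕ) := Matrix (Fin s) (Fin r) (Fin n → k)

variable {k : Type*} [Field k] {n s r : ℕ}

/-- Substitute elements `y a` of a `k`-algebra `A` for the basis vectors `x_a` of `V`. -/
def LinMat.subst {A : Type*} [Ring A] [Algebra k A] (M : LinMat k n s r) (y : Fin n → A) :
    Matrix (Fin s) (Fin r) A :=
  M.map fun c => ∑ a, c a • y a

/-- The matrix `M_p` over `k`; it is well defined up to a nonzero scalar. -/
def LinMat.at (M : LinMat k n s r) (p : ℙ k (Fin n → k)) : Matrix (Fin s) (Fin r) k :=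
  M.subst p.rep

/-- The set of `t`-minors of `M`, as polynomials in `k[x_1, …, x_n]`. (Choices of rows or columns
with repetition only add the polynomial `0`, and choices in another order only add signs.) -/
def LinMat.minors (M : LinMat k n s r) (t : ℕ) : Set (MvPolynomial (Fin n) k) :=
  {g | ∃ (e : Fin t → Fin s) (e' : Fin t → Fin r),
    g = ((M.subst (A := MvPolynomial (Fin n) k) MvPolynomial.X).submatrix e e').det}

/-- The variety `X_M` of points where all `n`-minors of `M` vanish. -/
def LinMat.X (M : LinMat k n s r) : Set (ℙ k (Fin n → k)) :=
  zeroLocus (M.minors n)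

end LinMat

/-! ## Quadratic algebras and the condition (G1)

A quadratic algebra `A = T(V)/(R)` is given by a `k`-algebra `A` with the family `x` of the
images in `A` of the basis vectors of `V`. -/

section Quadratic

variable (k : Type*) [Field k] {n : ℕ} {A : Type*} [Ring A] [Algebra k A]

/-- The value `∑ F_ab y_a y_b` in `A` of an element `F = ∑ F_ab x_a ⊗ x_b` of `V ⊗ V`. -/
def quadValue (y : Fin n → A) : Matrix (Fin n) (Fin n) k →ₗ[k] A where
  toFun F := ∑ a, ∑ b, F a b • (y a * y b)
  map_add' F G := by simp [add_smul, Finset.sum_add_distrib]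
  map_smul' c F := by simp [Finset.smul_sum, mul_smul]

/-- The space `R ⊆ V ⊗ V` of quadratic relations of the family `x`. -/
def quadRel (x : Fin n → A) : Submodule k (Matrix (Fin n) (Fin n) k) :=
  LinearMap.ker (quadValue k x)

/-- `A` is the quadratic algebra `T(V)/(R)`: the map from the free algebra is onto, and its
kernel is the two-sided ideal generated by the quadratic relations. -/
def IsQuadratic (x : Fin n → A) : Prop :=
  Function.Surjective (FreeAlgebra.lift k x) ∧
  ∀ w : FreeAlgebra k (Fin n), FreeAlgebra.lift k x w = 0 ↔
    w ∈ TwoSidedIdeal.span ((quadValue k (FreeAlgebra.ι k)) '' (quadRel k x : Set _))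

/-- The component `A_m`, spanned by the monomials of degree `m` in the generators. -/
def degPart (x : Fin n → A) (m : ℕ) : Submodule k A :=
  (Submodule.span k (Set.range x)) ^ m

/-- The ideal `A_{≥ 1}`. -/
def posPart (x : Fin n → A) : Submodule k A :=
  ⨆ m : ℕ, degPart k x (m + 1)

variable {k}

/-- The zero locus `𝒱(R)` of a space `R` of bilinear forms. -/
def biZero (R : Submodule k (Matrix (Fin n) (Fin n) k)) :
    Set (ℙ k (Fin n → k) × ℙ k (Fin n → k)) :=
  {pq | ∀ F ∈ R, ∑ a, ∑ b, F a b * (pq.1.rep a * pq.2.rep b) = 0}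

variable (k)

/-- `(E, σ)` is a geometric pair of `A`: `E` is a projective variety, `σ` is an automorphism of
the variety `E`, and `𝒱(R)` is the graph of `σ`. -/
def IsGeometricPair (x : Fin n → A) (E : Set (ℙ k (Fin n → k))) (σ : E ≃ E) : Prop :=
  IsProjectiveVariety E ∧ IsRegularMap σ ∧ IsRegularMap σ.symm ∧
  biZero (quadRel k x) = Set.range fun p : E => ((p : ℙ k (Fin n → k)), (σ p : ℙ k (Fin n → k)))

/-- `A` is a quadratic algebra which satisfies the (G1) condition. -/
def SatisfiesG1 (x : Fin n → A) : Prop :=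
  IsQuadratic k x ∧ ∃ (E : Set (ℙ k (Fin n → k))) (σ : E ≃ E), IsGeometricPair k x E σ

end Quadratic

/-! ## Linear resolutions, point varieties and point-exactness -/

section Resolution

variable (k : Type*) [Field k] {n : ℕ} {A : Type*} [Ring A] [Algebra k A]

/-- A linear resolution `⋯ → A(-2)^{s 2} → A(-1)^{s 1} → A → k_A → 0` of the right module
`k_A = A / A_{≥ 1}`. Elements of the free right modules are column vectors, and `d i` is the
matrix, with entries in `V`, of the map from the `(i+1)`-st module to the `i`-th module. The
algebra `A` is Koszul when such a resolution exists. -/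
structure RightLinearResolution (x : Fin n → A) where
  s : ℕ → ℕ
  d : ∀ i, LinMat k n (s i) (s (i + 1))
  s_zero : s 0 = 1
  exact_zero : ∀ v : Fin (s 0) → A,
    (∀ j, v j ∈ posPart k x) ↔ ∃ w, ((d 0).subst x).mulVec w = v
  exact_succ : ∀ i, ∀ v : Fin (s (i + 1)) → A,
    ((d i).subst x).mulVec v = 0 ↔ ∃ w, ((d (i + 1)).subst x).mulVec w = v

/-- A linear resolution `⋯ → A(-2)^{s 2} → A(-1)^{s 1} → A → k → 0` of the left module
`k = A / A_{≥ 1}`. Elements of the free left modules are row vectors, and `h i` is the matrix,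
with entries in `V`, of the map from the `(i+1)`-st module to the `i`-th module. -/
structure LeftLinearResolution (x : Fin n → A) where
  s : ℕ → ℕ
  h : ∀ i, LinMat k n (s (i + 1)) (s i)
  s_zero : s 0 = 1
  exact_zero : ∀ v : Fin (s 0) → A,
    (∀ j, v j ∈ posPart k x) ↔ ∃ w, Matrix.vecMul w ((h 0).subst x) = v
  exact_succ : ∀ i, ∀ v : Fin (s (i + 1)) → A,
    Matrix.vecMul v ((h i).subst x) = 0 ↔ ∃ w, Matrix.vecMul w ((h (i + 1)).subst x) = v

variable {k} {x : Fin n → A}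

/-- The variety `X_A`: the zeros of the `n`-minors of the second differential `A(-2)^{s 2} →
A(-1)^{s 1}`. It does not depend on the resolution. -/
def RightLinearResolution.X (P : RightLinearResolution k x) : Set (ℙ k (Fin n → k)) :=
  (P.d 1).X

/-- The variety `_A X`, defined from a linear resolution of the left module `k`. -/
def LeftLinearResolution.X (Q : LeftLinearResolution k x) : Set (ℙ k (Fin n → k)) :=
  (Q.h 1).X

/-- Right point-exactness at the degree `i + 1`: at all points of `X_A` the ranks of the two
differentials out of and into the `(i+1)`-st module add up to its rank. -/
def RightLinearResolution.PointExactAtSucc (P : RightLinearResolution k x) (i : ℕ) : Prop :=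
  ∀ p ∈ P.X, ((P.d i).at p).rank + ((P.d (i + 1)).at p).rank = P.s (i + 1)

/-- Left point-exactness at the degree `i + 1`. -/
def LeftLinearResolution.PointExactAtSucc (Q : LeftLinearResolution k x) (i : ℕ) : Prop :=
  ∀ p ∈ Q.X, ((Q.h i).at p).rank + ((Q.h (i + 1)).at p).rank = Q.s (i + 1)

/-- Semi-standard: `X_A = _A X`. -/
def IsSemiStandard (P : RightLinearResolution k x) (Q : LeftLinearResolution k x) : Prop :=
  P.X = Q.X

/-- Right and left point-exact at all degrees `1, …, l`. -/
def IsPointExactUpTo (P : RightLinearResolution k x) (Q : LeftLinearResolution k x) (l : ℕ) :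
    Prop :=
  ∀ i < l, P.PointExactAtSucc i ∧ Q.PointExactAtSucc i

end Resolution

/-! ## Regular normal elements and quotients -/

section Quotient

variable {A : Type*} [Ring A]

/-- `f` is regular: neither a left nor a right zero divisor. -/
def IsRegularElt (f : A) : Prop := ∀ a, a * f = 0 ∨ f * a = 0 → a = 0

/-- `f` is normal: `Af = fA`. -/
def IsNormalElt (f : A) : Prop := (Set.range fun a => a * f) = Set.range fun a => f * a

/-- The algebra `A/(f)`. -/
abbrev QuotBy (f : A) := (TwoSidedIdeal.span {f}).ringCon.Quotient

/-- The projection `A → A/(f)`. -/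
def quotMk (f : A) (a : A) : QuotBy f := (TwoSidedIdeal.span {f}).ringCon.mk' a

end Quotient

end KoszulPoint

end

/-!
# The geometric pair of a point-exact Koszul algebra and of its quotient by a normal element

The exact complex `A^{s 2} → A^{s 1} → A` at the start of the right resolution says that the
columns of the first differential form a basis of `V` and that, in this basis, the columns of the
second differential span the relations `R`
(`LinearPresentation.length_eq`, `LinearPresentation.mem_ker_iff`). Hence a
point `q` satisfies `(q, p) ∈ 𝒱(R)` exactly when its coordinate vector lies in the left kernel of
`(d_2)_p`, so that `X_A` is the second projection of `𝒱(R)`, and point-exactness in degree `1`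
makes this kernel at most one-dimensional. The left resolution is a right resolution over the
opposite algebra and gives the same for the first projection. As the two projections are the same
set `E`, the locus `𝒱(R)` is the graph of a bijection `σ` of `E`.

Any such bijection is automatically an automorphism of varieties
(`isGeometricPair_of_biZero_eq`): the vectors `G p`, `G ∈ R`, span the hyperplane orthogonal to
the unique `q` with `(q, p) ∈ 𝒱(R)`, so `q` is given by maximal minors, that is, by a column of an
adjugate matrix.

For the quotient by `f = ∑ F_ab x_a x_b`, composable pairs `(p, q), (q, r) ∈ 𝒱(R)` give a
representation of `A` on `k^4`, a truncated point module (`IsQuadratic.exists_pathRep`). Its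
matrix entries show that `𝒱(R_B)` is cut out of `𝒱(R)` by `F`
(`mem_biZero_quadRel_quotMk`), and, applied to `x_a f = f b` and `f x_a = b f`, that
`F(p, q) = 0 ↔ F(q, r) = 0` (`eval_eq_zero_iff_of_isNormalElt`). So
`E_B = {p ∈ E | F(p, σ p) = 0}` satisfies `σ(E_B) = E_B`, and `σ` restricts to `E_B`.
-/

open scoped LinearAlgebra.Projectivization

noncomputable section

namespace KoszulPoint

/-! ### Homomorphisms out of a quadratic algebra -/

section Algebra

variable {k : Type*} [Field k] {n : ℕ} {A : Type*} [Ring A] [Algebra k A] {x : Fin n → A}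

lemma map_quadValue {C : Type*} [Ring C] [Algebra k C] (φ : A →ₐ[k] C) (y : Fin n → A)
    (G : Matrix (Fin n) (Fin n) k) :
    φ (quadValue k y G) = quadValue k (fun a => φ (y a)) G := by
  simp [quadValue]

/-- The universal property of `T(V)/(R)`. -/
theorem IsQuadratic.exists_algHom (hx : IsQuadratic k x) {C : Type*} [Ring C] [Algebra k C]
    (y : Fin n → C) (hy : ∀ G ∈ quadRel k x, quadValue k y G = 0) :
    ∃ φ : A →ₐ[k] C, ∀ a, φ (x a) = y a := by
  have hker : ∀ w, FreeAlgebra.lift k x w = 0 → FreeAlgebra.lift k y w = 0 := by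
    intro w hw
    have hle : TwoSidedIdeal.span ((quadValue k (FreeAlgebra.ι k)) '' (quadRel k x : Set _)) ≤
        TwoSidedIdeal.ker (FreeAlgebra.lift k y) := by
      rw [TwoSidedIdeal.span_le]
      rintro _ ⟨G, hG, rfl⟩
      simpa [TwoSidedIdeal.mem_ker, map_quadValue] using hy G hG
    exact (TwoSidedIdeal.mem_ker _).1 (hle ((hx.2 w).1 hw))
  choose g hg using hx.1
  have key : ∀ w, FreeAlgebra.lift k y (g (FreeAlgebra.lift k x w)) = FreeAlgebra.lift k y w := by
    intro w
    rw [← sub_eq_zero, ← map_sub]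
    exact hker _ (by rw [map_sub, hg, sub_self])
  have key' : ∀ w a, FreeAlgebra.lift k x w = a →
      FreeAlgebra.lift k y (g a) = FreeAlgebra.lift k y w := by
    rintro w _ rfl
    exact key w
  refine ⟨{ toFun := fun a => FreeAlgebra.lift k y (g a)
            map_one' := by rw [key' 1 1 (by simp), map_one]
            map_zero' := by rw [key' 0 0 (by simp), map_zero]
            map_mul' := fun a b => by
              rw [key' (g a * g b) (a * b) (by rw [map_mul, hg, hg]), map_mul]
            map_add' := fun a b => by
              rw [key' (g a + g b) (a + b) (by rw [map_add, hg, hg]), map_add]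
            commutes' := fun r => by
              rw [key' (algebraMap k _ r) _ (AlgHom.commutes _ r), AlgHom.commutes] },
    fun a => ?_⟩
  change FreeAlgebra.lift k y (g (x a)) = y a
  rw [key' (FreeAlgebra.ι k a) _ (by simp)]
  simp

lemma quadValue_apply_apply (y : Fin n → Matrix (Fin 4) (Fin 4) k) (G : Matrix (Fin n) (Fin n) k)
    (i j : Fin 4) :
    quadValue k y G i j = ∑ a, ∑ b, G a b * (y a * y b) i j := by
  simp [quadValue, Matrix.sum_apply]

/-- The action of `x_a` (on row vectors) on the truncated point module with basis
`e_0, …, e_3`, in which `e_i x_a` is a multiple of `e_{i+1}` and the coefficients are `u a`, `v a`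
and `w a`. -/
def pathMatrix (u v w : Fin n → k) (a : Fin n) : Matrix (Fin 4) (Fin 4) k :=
  !![0, u a, 0, 0; 0, 0, v a, 0; 0, 0, 0, w a; 0, 0, 0, 0]

lemma sum_sum_eq_dotProduct (G : Matrix (Fin n) (Fin n) k) (u v : Fin n → k) :
    ∑ a, ∑ b, G a b * (u a * v b) = u ⬝ᵥ G.mulVec v := by
  simp only [dotProduct, Matrix.mulVec, Finset.mul_sum]
  exact Finset.sum_congr rfl fun a _ => Finset.sum_congr rfl fun b _ => by ring

lemma quadValue_pathMatrix (u v w : Fin n → k) (G : Matrix (Fin n) (Fin n) k) :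
    quadValue k (pathMatrix u v w) G =
      !![0, 0, u ⬝ᵥ G.mulVec v, 0; 0, 0, 0, v ⬝ᵥ G.mulVec w; 0, 0, 0, 0; 0, 0, 0, 0] := by
  ext i j
  rw [quadValue_apply_apply, ← sum_sum_eq_dotProduct, ← sum_sum_eq_dotProduct]
  fin_cases i <;> fin_cases j <;> simp [pathMatrix, Matrix.mul_apply, Fin.sum_univ_four]

/-- Consecutive zeros of the relations define a truncated point module. The vectors may be zero;
taking `w = 0` gives the shorter module of the pair `(u, v)`. -/
theorem IsQuadratic.exists_pathRep (hx : IsQuadratic k x) (u v w : Fin n → k)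
    (huv : ∀ G ∈ quadRel k x, u ⬝ᵥ G.mulVec v = 0) (hvw : ∀ G ∈ quadRel k x, v ⬝ᵥ G.mulVec w = 0) :
    ∃ φ : A →ₐ[k] Matrix (Fin 4) (Fin 4) k, ∀ a, φ (x a) = pathMatrix u v w a := by
  refine hx.exists_algHom _ fun G hG => ?_
  rw [quadValue_pathMatrix, huv G hG, hvw G hG]
  ext i j
  fin_cases i <;> fin_cases j <;> simp

/-- The quotient `A → A / A_{≥ 2}`, in the form of a map to `k ⊕ V`. It reads off the components
of degree `0` and `1`, without a grading on `A`. -/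
theorem IsQuadratic.exists_augmentation (hx : IsQuadratic k x) :
    ∃ θ : A →ₐ[k] TrivSqZeroExt k (Fin n → k),
      ∀ a, θ (x a) = TrivSqZeroExt.inr (Pi.single a 1) := by
  refine hx.exists_algHom _ fun G _ => ?_
  simp [quadValue]

lemma exists_quadValue_of_mem_degPart_two {f : A} (hf : f ∈ degPart k x 2) :
    ∃ F, quadValue k x F = f := by
  rw [degPart, pow_two, Submodule.span_mul_span] at hf
  change f ∈ LinearMap.range (quadValue k x)
  refine Submodule.span_le.2 ?_ hf
  rintro _ ⟨_, ⟨a, rfl⟩, _, ⟨b, rfl⟩, rfl⟩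
  refine ⟨Matrix.single a b 1, ?_⟩
  simp only [quadValue, LinearMap.coe_mk, AddHom.coe_mk, Matrix.single_apply]
  rw [Finset.sum_eq_single a, Finset.sum_eq_single b]
  · simp
  · intro c _ hc
    simp [hc.symm]
  · simp
  · intro c _ hc
    simp [hc.symm]
  · simp

end Algebra

/-! ### The quotient by a quadratic element -/

section Quotient

variable {k : Type*} [Field k] {n : ℕ} {A : Type*} [Ring A] [Algebra k A] {x : Fin n → A}

lemma quotMk_eq_zero_iff (f a : A) : quotMk f a = 0 ↔ a ∈ TwoSidedIdeal.span {f} := by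
  conv_rhs => rw [← TwoSidedIdeal.ker_ringCon_mk' (TwoSidedIdeal.span {f}), TwoSidedIdeal.mem_ker]
  rfl

lemma lift_quotMk (f : A) (w : FreeAlgebra k (Fin n)) :
    FreeAlgebra.lift k (fun a => quotMk f (x a)) w = quotMk f (FreeAlgebra.lift k x w) := by
  have h : FreeAlgebra.lift k (fun a => quotMk f (x a)) =
      ((TwoSidedIdeal.span {f}).ringCon.mkₐ (α := k)).comp (FreeAlgebra.lift k x) := by
    ext a
    simp [quotMk]
  rw [h]
  rfl

lemma quadValue_quotMk (f : A) (G : Matrix (Fin n) (Fin n) k) :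
    quadValue k (fun a => quotMk f (x a)) G = quotMk f (quadValue k x G) :=
  (map_quadValue ((TwoSidedIdeal.span {f}).ringCon.mkₐ (α := k)) x G).symm

lemma mem_quadRel_quotMk (f : A) (G : Matrix (Fin n) (Fin n) k) :
    G ∈ quadRel k (fun a => quotMk f (x a)) ↔ quadValue k x G ∈ TwoSidedIdeal.span {f} := by
  rw [quadRel, LinearMap.mem_ker, quadValue_quotMk, quotMk_eq_zero_iff]

lemma quadRel_le_quadRel_quotMk (f : A) : quadRel k x ≤ quadRel k (fun a => quotMk f (x a)) := by
  intro G hG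
  rw [mem_quadRel_quotMk, show quadValue k x G = 0 from hG]
  exact TwoSidedIdeal.zero_mem _

theorem IsQuadratic.quotient (hx : IsQuadratic k x) {f : A} (hf : f ∈ degPart k x 2) :
    IsQuadratic k (fun a => quotMk f (x a)) := by
  obtain ⟨F, rfl⟩ := exists_quadValue_of_mem_degPart_two hf
  set f := quadValue k x F
  refine ⟨fun b => ?_, fun w => ?_⟩
  · obtain ⟨a, rfl⟩ := (TwoSidedIdeal.span {f}).ringCon.mk'_surjective b
    obtain ⟨w, rfl⟩ := hx.1 a
    exact ⟨w, lift_quotMk f w⟩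
  set J := TwoSidedIdeal.span ((quadValue k (FreeAlgebra.ι k)) ''
    (quadRel k (fun a => quotMk f (x a)) : Set (Matrix (Fin n) (Fin n) k))) with hJ
  constructor
  · intro hw
    rw [lift_quotMk, quotMk_eq_zero_iff] at hw
    -- `A` maps to `T(V)/J` and this map kills `f`, so it factors through `A/(f)`.
    let π := J.ringCon.mkₐ (α := k)
    have hπ : ∀ w, π w = 0 ↔ w ∈ J := fun w => by
      conv_rhs => rw [← J.ker_ringCon_mk', TwoSidedIdeal.mem_ker]
      rfl
    have hval : ∀ G, quadValue k (fun a => π (FreeAlgebra.ι k a)) G =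
        π (quadValue k (FreeAlgebra.ι k) G) := fun G => (map_quadValue π _ G).symm
    obtain ⟨φ, hφ⟩ := hx.exists_algHom (fun a => π (FreeAlgebra.ι k a)) fun G hG => by
      rw [hval, hπ]
      exact TwoSidedIdeal.subset_span ⟨G, quadRel_le_quadRel_quotMk f hG, rfl⟩
    have hφw : ∀ w, φ (FreeAlgebra.lift k x w) = π w := fun w => by
      have : φ.comp (FreeAlgebra.lift k x) = π := by
        ext a
        simp [hφ]
      rw [← this]
      rfl
    have hle : TwoSidedIdeal.span {f} ≤ TwoSidedIdeal.ker φ := by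
      rw [TwoSidedIdeal.span_le, Set.singleton_subset_iff, SetLike.mem_coe, TwoSidedIdeal.mem_ker,
        map_quadValue]
      simp only [hφ]
      rw [hval, hπ]
      refine TwoSidedIdeal.subset_span ⟨F, ?_, rfl⟩
      rw [SetLike.mem_coe, mem_quadRel_quotMk]
      exact TwoSidedIdeal.subset_span rfl
    rw [← hπ, ← hφw]
    exact (TwoSidedIdeal.mem_ker _).1 (hle hw)
  · intro hw
    have hle : J ≤ TwoSidedIdeal.ker
        (FreeAlgebra.lift k (fun a => quotMk f (x a))) := by
      rw [hJ, TwoSidedIdeal.span_le]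
      rintro _ ⟨G, hG, rfl⟩
      rw [SetLike.mem_coe, TwoSidedIdeal.mem_ker, map_quadValue]
      have hG0 : quadValue k (fun a => quotMk f (x a)) G = 0 := hG
      simpa using hG0
    exact (TwoSidedIdeal.mem_ker _).1 (hle hw)

end Quotient

/-! ### Zero loci of bilinear forms in projective space -/

section Geometry

variable {k : Type*} [Field k] {n : ℕ}

lemma mem_biZero {R : Submodule k (Matrix (Fin n) (Fin n) k)} {q p : ℙ k (Fin n → k)} :
    (q, p) ∈ biZero R ↔ ∀ G ∈ R, q.rep ⬝ᵥ G.mulVec p.rep = 0 := by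
  simp only [biZero, Set.mem_ofPred_eq, sum_sum_eq_dotProduct]

/-- Membership in `𝒱(R)` may be tested on any representative of the first point. -/
lemma mk_mem_biZero {R : Submodule k (Matrix (Fin n) (Fin n) k)} {u : Fin n → k} (hu : u ≠ 0)
    {p : ℙ k (Fin n → k)} :
    (Projectivization.mk k u hu, p) ∈ biZero R ↔ ∀ G ∈ R, u ⬝ᵥ G.mulVec p.rep = 0 := by
  obtain ⟨c, hc⟩ := Projectivization.exists_smul_eq_mk_rep k u hu
  rw [mem_biZero, ← hc]
  simp [Units.smul_def, smul_dotProduct]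

lemma swap_mem_biZero_transpose {R : Submodule k (Matrix (Fin n) (Fin n) k)}
    {p q : ℙ k (Fin n → k)} :
    (q, p) ∈ biZero (R.comap (Matrix.transposeLinearEquiv (Fin n) (Fin n) k k).toLinearMap) ↔
      (p, q) ∈ biZero R := by
  rw [mem_biZero, mem_biZero]
  have h : ∀ G : Matrix (Fin n) (Fin n) k,
      q.rep ⬝ᵥ G.mulVec p.rep = p.rep ⬝ᵥ G.transpose.mulVec q.rep := fun G => by
    rw [Matrix.dotProduct_mulVec, Matrix.mulVec_transpose, dotProduct_comm]
  constructor
  · intro H G hG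
    have := H G.transpose (by simpa using hG)
    rwa [h, Matrix.transpose_transpose] at this
  · intro H G hG
    rw [h]
    exact H _ (by simpa using hG)

lemma exists_dotProduct_ne_zero_of_notMem {W : Submodule k (Fin n → k)} {w : Fin n → k}
    (hw : w ∉ W) : ∃ u : Fin n → k, (∀ y ∈ W, u ⬝ᵥ y = 0) ∧ u ⬝ᵥ w ≠ 0 := by
  obtain ⟨φ, hφ, hW⟩ := Submodule.exists_le_ker_of_notMem hw
  have h : ∀ y, (dotProductEquiv k (Fin n)).symm φ ⬝ᵥ y = φ y := fun y => by
    rw [← dotProductEquiv_apply_apply, LinearEquiv.apply_symm_apply]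
  exact ⟨(dotProductEquiv k (Fin n)).symm φ, fun y hy => by rw [h]; exact hW hy, by rwa [h]⟩

/-- The matrix of linear forms in the coordinates of the second argument whose `i`-th row
represents the bilinear form `G i`: at a point `v` that row is `G i *ᵥ v`. -/
def sliceMatrix (G : Fin n → Matrix (Fin n) (Fin n) k) :
    Matrix (Fin n) (Fin n) (MvPolynomial (Fin n) k) :=
  Matrix.of fun i a => ∑ b, MvPolynomial.C (G i a b) * MvPolynomial.X b

lemma sliceMatrix_isHomogeneous (G : Fin n → Matrix (Fin n) (Fin n) k) (i a : Fin n) :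
    (sliceMatrix G i a).IsHomogeneous 1 := by
  rw [sliceMatrix, Matrix.of_apply]
  exact MvPolynomial.IsHomogeneous.sum _ _ _ fun b _ => MvPolynomial.isHomogeneous_C_mul_X _ _

lemma map_eval_sliceMatrix (G : Fin n → Matrix (Fin n) (Fin n) k) (v : Fin n → k) :
    (MvPolynomial.eval v).mapMatrix (sliceMatrix G) = Matrix.of fun i => (G i).mulVec v := by
  ext i a
  simp [sliceMatrix, Matrix.mulVec, dotProduct]

lemma isHomogeneous_det {ι : Type*} [Fintype ι] [DecidableEq ι]
    (N : Matrix ι ι (MvPolynomial (Fin n) k)) (m : ι → ℕ)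
    (h : ∀ i j, (N i j).IsHomogeneous (m i)) : N.det.IsHomogeneous (∑ i, m i) := by
  rw [← Matrix.det_transpose, Matrix.det_apply]
  refine MvPolynomial.IsHomogeneous.sum _ _ _ fun s _ => ?_
  have := MvPolynomial.IsHomogeneous.prod Finset.univ (fun i => N i (s i)) m fun i _ => h i (s i)
  rcases Int.units_eq_one_or (Equiv.Perm.sign s) with hs | hs
  · simpa [hs] using this
  · simpa [hs] using this.neg

/-- A point `p` lies in the second projection of `𝒱(R)` when the vectors `G p`, `G ∈ R`, do not
span the whole space, that is, when all determinants of `n` of them vanish. -/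
theorem isProjectiveVariety_snd_biZero (R : Submodule k (Matrix (Fin n) (Fin n) k)) :
    IsProjectiveVariety {p : ℙ k (Fin n → k) | ∃ q, (q, p) ∈ biZero R} := by
  refine ⟨{g | ∃ G : Fin n → Matrix (Fin n) (Fin n) k, (∀ i, G i ∈ R) ∧ g = (sliceMatrix G).det},
    ?_, ?_⟩
  · rintro _ ⟨G, _, rfl⟩
    exact ⟨_, isHomogeneous_det _ (fun _ => 1) (sliceMatrix_isHomogeneous G)⟩
  ext p
  have hev : ∀ G : Fin n → Matrix (Fin n) (Fin n) k,
      MvPolynomial.eval p.rep (sliceMatrix G).det =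
        (Matrix.of fun i => (G i).mulVec p.rep).det := fun G => by
    rw [RingHom.map_det, map_eval_sliceMatrix]
  constructor
  · rintro ⟨q, hq⟩ _ ⟨G, hG, rfl⟩
    rw [hev, ← Matrix.exists_mulVec_eq_zero_iff]
    refine ⟨q.rep, q.rep_nonzero, funext fun i => ?_⟩
    change (G i).mulVec p.rep ⬝ᵥ q.rep = 0
    rw [dotProduct_comm]
    exact mem_biZero.1 hq _ (hG i)
  · intro hp
    let W : Submodule k (Fin n → k) := R.map ((Matrix.mulVecBilin k k).flip p.rep)
    have hW : W ≠ ⊤ := by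
      intro htop
      have h1 : ∀ i, ∃ G ∈ R, G.mulVec p.rep = Pi.single i 1 := fun i => by
        have : (Pi.single i 1 : Fin n → k) ∈ W := htop ▸ Submodule.mem_top
        simpa [W] using this
      choose G hG hGp using h1
      have h2 := hp _ ⟨G, hG, rfl⟩
      rw [hev, show (Matrix.of fun i => (G i).mulVec p.rep) = 1 by
        ext i j
        simp [hGp, Matrix.one_apply, Pi.single_apply, eq_comm], Matrix.det_one] at h2
      exact one_ne_zero h2
    obtain ⟨w, hw⟩ : ∃ w, w ∉ W := by
      by_contra! h
      exact hW (eq_top_iff.2 fun w _ => h w)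
    obtain ⟨u, hu, huw⟩ := exists_dotProduct_ne_zero_of_notMem hw
    have hu0 : u ≠ 0 := by
      rintro rfl
      simp at huw
    exact ⟨Projectivization.mk k u hu0, (mk_mem_biZero hu0).2 fun G hG =>
      hu _ ⟨G, hG, by simp⟩⟩

lemma dotProduct_adjugate_col {N : Matrix (Fin n) (Fin n) k} (c : Fin n) (w : Fin n → k) :
    (fun j => N.adjugate j c) ⬝ᵥ w = (N.updateRow c w).det := by
  have h1 : ∀ j, N.adjugate j c = (N.updateRow c w).adjugate j c := fun j => by
    rw [Matrix.adjugate_apply, Matrix.adjugate_apply, Matrix.updateRow_idem]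
  have h2 := congrFun (congrFun (Matrix.mul_adjugate (N.updateRow c w)) c) c
  simp only [Matrix.mul_apply, Matrix.updateRow_self, Matrix.smul_apply, Matrix.one_apply_eq,
    smul_eq_mul, mul_one] at h2
  rw [← h2, dotProduct]
  exact Finset.sum_congr rfl fun j _ => by rw [h1, mul_comm]

/-- If `𝒱(R)` is the graph of `ψ`, read from the second factor to the first, then `ψ` is a
morphism: near `p` it is given by the signed maximal minors of `n - 1` vectors `G_i p` which
span the hyperplane orthogonal to `ψ p`. -/
theorem isRegularMap_of_biZero (R : Submodule k (Matrix (Fin n) (Fin n) k))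
    {E : Set (ℙ k (Fin n → k))} (ψ : E → E)
    (h : ∀ (p : E) (q : ℙ k (Fin n → k)), (q, p.1) ∈ biZero R ↔ q = (ψ p).1) :
    IsRegularMap ψ := by
  intro p
  set u := (ψ p).1.rep with hu
  obtain ⟨c, hc⟩ : ∃ c, u c ≠ 0 := Function.ne_iff.1 (ψ p).1.rep_nonzero
  -- Uniqueness of `ψ p` forces the vectors `G p` to fill the hyperplane orthogonal to `u`.
  have hperp : ∀ w : Fin n → k, u ⬝ᵥ w = 0 → ∃ G ∈ R, G.mulVec p.1.rep = w := by
    intro w hw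
    by_contra hcon
    have hwW : w ∉ R.map ((Matrix.mulVecBilin k k).flip p.1.rep) := by
      rintro ⟨G, hG, rfl⟩
      exact hcon ⟨G, hG, by simp⟩
    obtain ⟨u', hu', hne⟩ := exists_dotProduct_ne_zero_of_notMem hwW
    have hu0 : u' ≠ 0 := by
      rintro rfl
      simp at hne
    have hmk := (h p _).1 ((mk_mem_biZero hu0).2 fun G hG => hu' _ ⟨G, hG, by simp⟩)
    obtain ⟨t, ht⟩ := Projectivization.exists_smul_eq_mk_rep k u' hu0
    rw [hmk, ← hu] at ht
    rw [← ht, Units.smul_def, smul_dotProduct, smul_eq_mul] at hw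
    exact hne ((mul_eq_zero.1 hw).resolve_left t.ne_zero)
  -- For `i ≠ c` these vectors form a basis of that hyperplane; the one for `i = c` is zero, and the
  -- `c`-th column of the adjugate does not involve it.
  have hG : ∀ i, ∃ G ∈ R, G.mulVec p.1.rep = Pi.single i (u c) - Pi.single c (u i) := fun i =>
    hperp _ (by simp [dotProduct_sub, mul_comm])
  choose G hGR hGp using hG
  have hev : ∀ (v : Fin n → k) (j : Fin n),
      MvPolynomial.eval v ((sliceMatrix G).adjugate j c) =
        (Matrix.of fun i => (G i).mulVec v).adjugate j c := fun v j => by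
    rw [← map_eval_sliceMatrix, ← RingHom.map_adjugate]
    rfl
  refine ⟨∑ i, (if i = c then 0 else 1), fun j => (sliceMatrix G).adjugate j c, fun j => ?_, ?_, ?_⟩
  · simp only [Matrix.adjugate_apply]
    refine isHomogeneous_det _ _ fun i a => ?_
    rw [Matrix.updateRow_apply]
    split_ifs with hi
    · rw [Pi.single_apply]
      split_ifs
      · exact MvPolynomial.isHomogeneous_one _ _
      · exact MvPolynomial.isHomogeneous_zero _ _ _
    · exact sliceMatrix_isHomogeneous G i a
  · intro h0
    have h1 := (hev _ c).symm.trans (congrFun h0 c)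
    rw [Matrix.adjugate_apply, Pi.zero_apply] at h1
    obtain ⟨v, hv, hv0⟩ := Matrix.exists_mulVec_eq_zero_iff.2 h1
    refine hv (funext fun i => ?_)
    have hvc : v c = 0 := by
      have := congrFun hv0 c
      simpa [Matrix.mulVec] using this
    by_cases hi : i = c
    · rw [hi, hvc, Pi.zero_apply]
    have := congrFun hv0 i
    simp only [Matrix.mulVec, Matrix.updateRow_ne hi, Matrix.of_apply, Pi.zero_apply] at this
    change (G i).mulVec p.1.rep ⬝ᵥ v = 0 at this
    rw [hGp, sub_dotProduct, single_dotProduct, single_dotProduct, hvc, mul_zero, sub_zero] at this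
    exact (mul_eq_zero.1 this).resolve_left hc
  · intro q hq
    refine ((h q _).1 ((mk_mem_biZero hq).2 fun H hH => ?_)).symm
    simp only [hev]
    rw [dotProduct_adjugate_col, ← Matrix.exists_mulVec_eq_zero_iff]
    refine ⟨(ψ q).1.rep, (ψ q).1.rep_nonzero, funext fun i => ?_⟩
    have hz := mem_biZero.1 ((h q _).2 rfl)
    by_cases hi : i = c
    · subst hi
      simp only [Matrix.mulVec, Matrix.updateRow_self, Pi.zero_apply]
      rw [dotProduct_comm]
      exact hz H hH
    · simp only [Matrix.mulVec, Matrix.updateRow_ne hi, Pi.zero_apply]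
      rw [dotProduct_comm]
      exact hz (G i) (hGR i)

/-- If `𝒱(R)` is the graph of a bijection of a set `E`, then `E` is a variety and the bijection
is an automorphism of it. -/
theorem isGeometricPair_of_biZero_eq {A : Type*} [Ring A] [Algebra k A] {x : Fin n → A}
    {E : Set (ℙ k (Fin n → k))} {σ : E ≃ E}
    (h : ∀ p q, (p, q) ∈ biZero (quadRel k x) ↔ ∃ hp : p ∈ E, q = (σ ⟨p, hp⟩).1) :
    IsGeometricPair k x E σ := by
  refine ⟨?_, ?_, ?_, ?_⟩
  · convert isProjectiveVariety_snd_biZero (quadRel k x) using 1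
    ext p
    constructor
    · intro hp
      refine ⟨(σ.symm ⟨p, hp⟩).1, (h _ _).2 ⟨(σ.symm ⟨p, hp⟩).2, by simp⟩⟩
    · rintro ⟨q, hq⟩
      obtain ⟨hp, rfl⟩ := (h _ _).1 hq
      exact (σ _).2
  · refine isRegularMap_of_biZero ((quadRel k x).comap
      (Matrix.transposeLinearEquiv (Fin n) (Fin n) k k).toLinearMap) σ fun p q => ?_
    rw [swap_mem_biZero_transpose, h]
    exact ⟨fun ⟨_, hq⟩ => hq, fun hq => ⟨p.2, hq⟩⟩
  · refine isRegularMap_of_biZero (quadRel k x) σ.symm fun p q => (h _ _).trans ?_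
    constructor
    · rintro ⟨hq, hp⟩
      rw [show p = σ ⟨q, hq⟩ from Subtype.ext hp]
      simp
    · rintro rfl
      exact ⟨(σ.symm p).2, by simp⟩
  · ext ⟨p, q⟩
    rw [h]
    constructor
    · rintro ⟨hp, rfl⟩
      exact ⟨⟨p, hp⟩, rfl⟩
    · rintro ⟨p', hp'⟩
      obtain ⟨rfl, rfl⟩ := Prod.mk.inj hp'
      exact ⟨p'.2, rfl⟩

end Geometry

/-! ### Minors and kernels of matrices of linear forms -/

section MinorsRank

variable {k : Type*} [Field k] {n s r : ℕ}

lemma exists_vecMul_eq_zero_iff_minors (hs : s = n) (N : Matrix (Fin s) (Fin r) k) :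
    (∃ u : Fin s → k, u ≠ 0 ∧ Matrix.vecMul u N = 0) ↔
      ∀ (e : Fin n → Fin s) (e' : Fin n → Fin r), (N.submatrix e e').det = 0 := by
  subst hs
  constructor
  · rintro ⟨u, hu, hN⟩ e e'
    by_cases he : Function.Injective e
    · rw [← Matrix.exists_vecMul_eq_zero_iff]
      let ε := Equiv.ofBijective e (Finite.injective_iff_bijective.1 he)
      refine ⟨u ∘ e, fun h => hu (funext fun i => ?_), funext fun l => ?_⟩
      · have := congrFun h (ε.symm i)
        rwa [Function.comp_apply, show e (ε.symm i) = i from ε.apply_symm_apply i] at this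
      · have := congrFun hN (e' l)
        simp only [Matrix.vecMul, dotProduct, Pi.zero_apply] at this ⊢
        rw [← this]
        exact Equiv.sum_comp ε fun i => u i * N i (e' l)
    · rw [Function.Injective] at he
      push Not at he
      obtain ⟨i, j, hij, hne⟩ := he
      refine Matrix.det_zero_of_row_eq hne (funext fun l => ?_)
      simp [hij]
  · intro H
    have hspan : Submodule.span k (Set.range N.col) ≠ ⊤ := by
      intro htop
      obtain ⟨v, hv, -, hli⟩ := Submodule.exists_fun_fin_finrank_span_eq k (Set.range N.col)
      have hfr : Module.finrank k (Submodule.span k (Set.range N.col)) = s := by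
        rw [htop, finrank_top, Module.finrank_fin_fun]
      choose e' he' using hv
      have hli' := hli.comp _ (Fin.cast_injective hfr.symm)
      have hcol : (N.submatrix id (e' ∘ Fin.cast hfr.symm)).col = v ∘ Fin.cast hfr.symm := by
        funext l
        simp only [Function.comp_apply, ← he']
        rfl
      rw [← hcol, Matrix.linearIndependent_cols_iff_isUnit, Matrix.isUnit_iff_isUnit_det, H] at hli'
      exact not_isUnit_zero hli'
    obtain ⟨w, hw⟩ : ∃ w, w ∉ Submodule.span k (Set.range N.col) := by
      by_contra! h
      exact hspan (eq_top_iff.2 fun w _ => h w)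
    obtain ⟨u, hu, huw⟩ := exists_dotProduct_ne_zero_of_notMem hw
    refine ⟨u, ?_, funext fun l => hu _ (Submodule.subset_span ⟨l, rfl⟩)⟩
    rintro rfl
    simp at huw

lemma LinMat.mem_X {M : LinMat k n s r} {p : ℙ k (Fin n → k)} :
    p ∈ M.X ↔ ∀ (e : Fin n → Fin s) (e' : Fin n → Fin r), ((M.at p).submatrix e e').det = 0 := by
  have hev : ∀ (e : Fin n → Fin s) (e' : Fin n → Fin r),
      MvPolynomial.eval p.rep
        ((M.subst (A := MvPolynomial (Fin n) k) MvPolynomial.X).submatrix e e').det =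
      ((M.at p).submatrix e e').det := fun e e' => by
    rw [RingHom.map_det]
    congr 1
    ext i j
    simp [LinMat.at, LinMat.subst]
  constructor
  · intro h e e'
    rw [← hev]
    exact h _ ⟨e, e', rfl⟩
  · rintro h _ ⟨e, e', rfl⟩
    rw [hev, h]

lemma LinMat.transpose_X (M : LinMat k n s r) : LinMat.X (n := n) M.transpose = M.X := by
  ext p
  rw [LinMat.mem_X, LinMat.mem_X, forall_comm]
  refine forall₂_congr fun e e' => ?_
  rw [← Matrix.det_transpose]
  rfl

/-- A matrix with `s` rows and rank at least `s - 1` has left kernel of dimension at most `1`. -/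
lemma eq_smul_of_vecMul_eq_zero {N : Matrix (Fin s) (Fin r) k} (hN : s ≤ N.rank + 1)
    {u v : Fin s → k} (hu : u ≠ 0) (hu0 : Matrix.vecMul u N = 0) (hv0 : Matrix.vecMul v N = 0) :
    ∃ t : k, v = t • u := by
  have hrank : Module.finrank k (LinearMap.range N.vecMulLinear) = N.rank := by
    rw [← Matrix.mulVecLin_transpose, ← Matrix.rank_transpose N]
    rfl
  have hle : Module.finrank k (LinearMap.ker N.vecMulLinear) ≤ 1 := by
    have := LinearMap.finrank_range_add_finrank_ker N.vecMulLinear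
    rw [Module.finrank_fin_fun, hrank] at this
    omega
  have h1 : Module.finrank k (LinearMap.ker N.vecMulLinear) = 1 := by
    refine le_antisymm hle (Nat.one_le_iff_ne_zero.2 fun h0 => ?_)
    rw [Submodule.finrank_eq_zero] at h0
    have : u ∈ LinearMap.ker N.vecMulLinear := by simpa using hu0
    rw [h0, Submodule.mem_bot] at this
    exact hu this
  obtain ⟨t, ht⟩ := (finrank_eq_one_iff_of_nonzero' (⟨u, by simpa using hu0⟩ :
    LinearMap.ker N.vecMulLinear) (fun h => hu (congrArg Subtype.val h))).1 h1
      ⟨v, by simpa using hv0⟩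
  exact ⟨t, (congrArg Subtype.val ht).symm⟩

end MinorsRank

/-! ### Linear presentations and quadratic relations -/

section Presentation

variable {k : Type*} [Field k] {n : ℕ} {A : Type*} [Ring A] [Algebra k A] {x : Fin n → A}

lemma quadValue_transpose_mul {s : ℕ} (C g : Matrix (Fin s) (Fin n) k) :
    quadValue k x (C.transpose * g) =
      ∑ j, Fintype.linearCombination k x (C j) * Fintype.linearCombination k x (g j) := by
  simp only [quadValue, LinearMap.coe_mk, AddHom.coe_mk, Matrix.mul_apply, Matrix.transpose_apply,
    Fintype.linearCombination_apply, Finset.sum_mul_sum, Finset.sum_smul, smul_mul_smul_comm]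
  rw [Finset.sum_comm_cycle]

/-- The start `A^r → A^s → A_{≥ 1} → 0` of a linear resolution of right modules: the rows of `C`
are the entries of the map `A^s → A` in the basis `x`, and `M` is the matrix of `A^r → A^s`. -/
structure LinearPresentation (x : Fin n → A) {s r : ℕ} (C : Matrix (Fin s) (Fin n) k)
    (M : LinMat k n s r) : Prop where
  generate : ∀ a, ∃ w : Fin s → A, ∑ j, Fintype.linearCombination k x (C j) * w j = x a
  exact : ∀ v : Fin s → A, ∑ j, Fintype.linearCombination k x (C j) * v j = 0 ↔
    ∃ w : Fin r → A, ∀ j, ∑ l, Fintype.linearCombination k x (M j l) * w l = v j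

namespace LinearPresentation

variable {s r : ℕ} {C : Matrix (Fin s) (Fin n) k} {M : LinMat k n s r}
  {θ : A →ₐ[k] TrivSqZeroExt k (Fin n → k)}

lemma aug_linearCombination (hθ : ∀ a, θ (x a) = TrivSqZeroExt.inr (Pi.single a 1))
    (c : Fin n → k) : θ (Fintype.linearCombination k x c) = TrivSqZeroExt.inr c := by
  rw [Fintype.linearCombination_apply, map_sum]
  simp only [map_smul, hθ, ← TrivSqZeroExt.inr_smul]
  rw [← TrivSqZeroExt.inr_sum]
  congr 1
  ext a
  simp [Finset.sum_apply, Pi.single_apply]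

lemma aug_sum_mul (hθ : ∀ a, θ (x a) = TrivSqZeroExt.inr (Pi.single a 1)) {m : ℕ}
    (c : Fin m → Fin n → k) (w : Fin m → A) :
    θ (∑ j, Fintype.linearCombination k x (c j) * w j) =
      TrivSqZeroExt.inr (∑ j, (θ (w j)).fst • c j) := by
  rw [map_sum, TrivSqZeroExt.inr_sum]
  refine Finset.sum_congr rfl fun j _ => ?_
  rw [map_mul, aug_linearCombination hθ]
  ext <;> simp

/-- The linear forms `C j` span `V`: compare the components of degree `1` in `generate`. -/
lemma exists_leftInverse (h : LinearPresentation x C M)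
    (hθ : ∀ a, θ (x a) = TrivSqZeroExt.inr (Pi.single a 1)) :
    ∃ μ : Matrix (Fin n) (Fin s) k, μ * C = 1 := by
  choose w hw using h.generate
  refine ⟨Matrix.of fun a j => (θ (w a j)).fst, ?_⟩
  ext a b
  have := congrArg TrivSqZeroExt.snd (aug_sum_mul hθ C (w a))
  rw [hw, hθ] at this
  have := congrFun this b
  simp only [TrivSqZeroExt.snd_inr, Finset.sum_apply, Pi.smul_apply, smul_eq_mul] at this
  rw [Matrix.mul_apply, Matrix.one_apply]
  simp only [Matrix.of_apply]
  rw [← this, Pi.single_apply]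
  simp [eq_comm]

/-- The linear forms `C j` are independent: a scalar relation between them would be in the image
of `M`, whose elements have no component of degree `0`. -/
lemma eq_zero_of_vecMul (h : LinearPresentation x C M)
    (hθ : ∀ a, θ (x a) = TrivSqZeroExt.inr (Pi.single a 1)) {t : Fin s → k}
    (ht : Matrix.vecMul t C = 0) : t = 0 := by
  have h0 : ∑ j, Fintype.linearCombination k x (C j) * algebraMap k A (t j) = 0 := by
    have : Fintype.linearCombination k x (Matrix.vecMul t C) = 0 := by rw [ht, map_zero]
    rw [Matrix.vecMul_eq_sum, map_sum] at this
    rw [← this]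
    refine Finset.sum_congr rfl fun j _ => ?_
    rw [map_smul, ← Algebra.commutes, Algebra.smul_def]
  obtain ⟨w, hw⟩ := (h.exact _).1 h0
  funext j
  have := congrArg TrivSqZeroExt.fst ((congrArg θ (hw j)).symm.trans (aug_sum_mul hθ (M j) w))
  rw [AlgHom.commutes] at this
  simpa [TrivSqZeroExt.algebraMap_eq_inl] using this

lemma length_eq (h : LinearPresentation x C M)
    (hθ : ∀ a, θ (x a) = TrivSqZeroExt.inr (Pi.single a 1)) : s = n := by
  obtain ⟨μ, hμ⟩ := h.exists_leftInverse hθ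
  apply le_antisymm
  · have := LinearMap.finrank_le_finrank_of_injective (f := C.vecMulLinear)
      ((injective_iff_map_eq_zero _).2 fun t ht => h.eq_zero_of_vecMul hθ ht)
    simpa using this
  · have := LinearMap.finrank_le_finrank_of_injective (f := C.mulVecLin)
      (Function.LeftInverse.injective (g := μ.mulVec) fun q => by
        simp [Matrix.mulVec_mulVec, hμ])
    simpa using this

/-- The tensors `∑ j, C j ⊗ M j l` span the relations of `x`, so that the zeros of the relations
are the vectors `q` whose coordinates `C *ᵥ q` are in the left kernel of `M` at `p`. -/
lemma mem_ker_iff (h : LinearPresentation x C M)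
    (hθ : ∀ a, θ (x a) = TrivSqZeroExt.inr (Pi.single a 1)) (q p : Fin n → k) :
    (∀ G ∈ quadRel k x, q ⬝ᵥ G.mulVec p = 0) ↔
      Matrix.vecMul (C.mulVec q) (M.subst p) = 0 := by
  have hform : ∀ g : Matrix (Fin s) (Fin n) k,
      q ⬝ᵥ (C.transpose * g).mulVec p = C.mulVec q ⬝ᵥ g.mulVec p := fun g => by
    rw [← Matrix.mulVec_mulVec, Matrix.dotProduct_mulVec, Matrix.vecMul_transpose]
  have hsubst : ∀ j l, M.subst p j l = M j l ⬝ᵥ p := fun j l => by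
    simp [LinMat.subst, dotProduct]
  constructor
  · intro H
    funext l
    have := H (C.transpose * Matrix.of fun j => M j l) (by
      rw [quadRel, LinearMap.mem_ker, quadValue_transpose_mul]
      refine (h.exact _).2 ⟨Pi.single l 1, fun j => ?_⟩
      rw [Finset.sum_eq_single l (fun l' _ hl' => by simp [hl']) (by simp)]
      simp
      rfl)
    rw [hform] at this
    simp only [Matrix.vecMul, hsubst, Pi.zero_apply]
    exact this
  · intro H G hG
    obtain ⟨μ, hμ⟩ := h.exists_leftInverse hθ
    set g := μ.transpose * G with hg
    have hGg : G = C.transpose * g := by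
      rw [hg, ← Matrix.mul_assoc, ← Matrix.transpose_mul, hμ, Matrix.transpose_one, Matrix.one_mul]
    have h0 : quadValue k x (C.transpose * g) = 0 := hGg ▸ hG
    rw [quadValue_transpose_mul] at h0
    obtain ⟨w, hw⟩ := (h.exact _).1 h0
    have hgp : g.mulVec p = (M.subst p).mulVec fun l => (θ (w l)).fst := by
      funext j
      have := congrArg TrivSqZeroExt.snd ((congrArg θ (hw j)).symm.trans (aug_sum_mul hθ (M j) w))
      rw [aug_linearCombination hθ, TrivSqZeroExt.snd_inr, TrivSqZeroExt.snd_inr] at this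
      simp only [Matrix.mulVec, this, hsubst]
      rw [sum_dotProduct, dotProduct]
      simp [mul_comm]
    rw [hGg, hform, hgp, Matrix.dotProduct_mulVec, H, zero_dotProduct]

lemma mem_X_iff (h : LinearPresentation x C M)
    (hθ : ∀ a, θ (x a) = TrivSqZeroExt.inr (Pi.single a 1)) (p : ℙ k (Fin n → k)) :
    p ∈ M.X ↔ ∃ q, (q, p) ∈ biZero (quadRel k x) := by
  obtain ⟨μ, hμ⟩ := h.exists_leftInverse hθ
  have hs := h.length_eq hθ
  rw [LinMat.mem_X, ← exists_vecMul_eq_zero_iff_minors hs]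
  have hCμ : C * μ = 1 := by
    subst hs
    exact mul_eq_one_comm.1 hμ
  constructor
  · rintro ⟨u, hu, hu0⟩
    have hμu : C.mulVec (μ.mulVec u) = u := by simp [Matrix.mulVec_mulVec, hCμ]
    have hne : μ.mulVec u ≠ 0 := fun h0 => hu (by rw [← hμu, h0, Matrix.mulVec_zero])
    refine ⟨Projectivization.mk k _ hne, (mk_mem_biZero hne).2 ((h.mem_ker_iff hθ _ _).2 ?_)⟩
    rw [hμu]
    exact hu0
  · rintro ⟨q, hq⟩
    refine ⟨C.mulVec q.rep, fun h0 => q.rep_nonzero ?_,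
      (h.mem_ker_iff hθ _ _).1 (mem_biZero.1 hq)⟩
    rw [← Matrix.one_mulVec q.rep, ← hμ, ← Matrix.mulVec_mulVec, h0, Matrix.mulVec_zero]

lemma unique_of_rank (h : LinearPresentation x C M)
    (hθ : ∀ a, θ (x a) = TrivSqZeroExt.inr (Pi.single a 1)) {p q q' : ℙ k (Fin n → k)}
    (hr : s ≤ (M.at p).rank + 1) (hq : (q, p) ∈ biZero (quadRel k x))
    (hq' : (q', p) ∈ biZero (quadRel k x)) : q = q' := by
  obtain ⟨μ, hμ⟩ := h.exists_leftInverse hθ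
  have hinv : ∀ u, μ.mulVec (C.mulVec u) = u := fun u => by simp [Matrix.mulVec_mulVec, hμ]
  obtain ⟨t, ht⟩ := eq_smul_of_vecMul_eq_zero hr
    (fun h0 => q'.rep_nonzero (by rw [← hinv q'.rep, h0, Matrix.mulVec_zero]))
    ((h.mem_ker_iff hθ _ _).1 (mem_biZero.1 hq')) ((h.mem_ker_iff hθ _ _).1 (mem_biZero.1 hq))
  rw [← q.mk_rep, ← q'.mk_rep, Projectivization.mk_eq_mk_iff']
  refine ⟨t, ?_⟩
  rw [← hinv q.rep, ht, Matrix.mulVec_smul, hinv]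

end LinearPresentation
end Presentation

/-! ### The presentations given by the right and the left resolution -/

section Resolutions

variable {k : Type*} [Field k] {n : ℕ} {A : Type*} [Ring A] [Algebra k A] {x : Fin n → A}

lemma mem_posPart (a : Fin n) : x a ∈ posPart k x :=
  Submodule.mem_iSup_of_mem 0 (by
    rw [degPart, zero_add, pow_one]
    exact Submodule.subset_span ⟨a, rfl⟩)

theorem RightLinearResolution.linearPresentation (P : RightLinearResolution k x) (i₀ : Fin (P.s 0)) :
    LinearPresentation x (fun j => P.d 0 i₀ j) (P.d 1) := by
  have hsub : ∀ i : Fin (P.s 0), i = i₀ := fun i => by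
    have := P.s_zero
    omega
  refine ⟨fun a => ?_, fun v => ?_⟩
  · obtain ⟨w, hw⟩ := (P.exact_zero fun _ => x a).1 fun _ => mem_posPart a
    exact ⟨w, congrFun hw i₀⟩
  · refine Iff.trans ⟨fun h => funext fun i => ?_, fun h => congrFun h i₀⟩
      ((P.exact_succ 0 v).trans (exists_congr fun w => funext_iff))
    rw [hsub i]
    exact h

lemma linearCombination_op (c : Fin n → k) :
    Fintype.linearCombination k (fun a => MulOpposite.op (x a)) c =
      MulOpposite.op (Fintype.linearCombination k x c) := by
  simp [Fintype.linearCombination_apply]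

/-- A left resolution over `A` is a right resolution over the opposite algebra. -/
theorem LeftLinearResolution.linearPresentation (Q : LeftLinearResolution k x) (i₀ : Fin (Q.s 0)) :
    LinearPresentation (fun a => MulOpposite.op (x a)) (fun j => Q.h 0 j i₀)
      (Matrix.transpose (Q.h 1)) := by
  have hsub : ∀ i : Fin (Q.s 0), i = i₀ := fun i => by
    have := Q.s_zero
    omega
  refine ⟨fun a => ?_, fun v => ?_⟩
  · obtain ⟨w, hw⟩ := (Q.exact_zero fun _ => x a).1 fun _ => mem_posPart a
    refine ⟨fun j => MulOpposite.op (w j), ?_⟩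
    simp only [linearCombination_op, ← MulOpposite.op_mul, ← Finset.op_sum]
    exact congrArg MulOpposite.op (congrFun hw i₀)
  · have h1 : ∑ j, Fintype.linearCombination k (fun a => MulOpposite.op (x a)) (Q.h 0 j i₀) * v j =
        MulOpposite.op (Matrix.vecMul (fun j => (v j).unop) ((Q.h 0).subst x) i₀) := by
      simp only [linearCombination_op, Matrix.vecMul, dotProduct, Finset.op_sum,
        MulOpposite.op_mul, MulOpposite.op_unop]
      rfl
    have h2 : ∀ w : Fin (Q.s 2) → A, ∀ j,
        ∑ l, Fintype.linearCombination k (fun a => MulOpposite.op (x a))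
          (Matrix.transpose (Q.h 1) j l) * MulOpposite.op (w l) =
        MulOpposite.op (Matrix.vecMul w ((Q.h 1).subst x) j) := fun w j => by
      simp only [linearCombination_op, Matrix.vecMul, dotProduct, Finset.op_sum,
        MulOpposite.op_mul]
      rfl
    rw [h1, MulOpposite.op_eq_zero_iff]
    refine Iff.trans ⟨fun h => funext fun i => ?_, fun h => congrFun h i₀⟩
      ((Q.exact_succ 0 fun j => (v j).unop).trans ?_)
    · rw [hsub i]
      exact h
    constructor
    · rintro ⟨w, hw⟩
      exact ⟨fun l => MulOpposite.op (w l), fun j => by rw [h2, hw, MulOpposite.op_unop]⟩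
    · rintro ⟨w, hw⟩
      refine ⟨fun l => (w l).unop, funext fun j => ?_⟩
      rw [← hw j, ← MulOpposite.unop_op (Matrix.vecMul _ _ j), ← h2]
      simp

lemma quadRel_op : quadRel k (fun a => MulOpposite.op (x a)) =
    (quadRel k x).comap (Matrix.transposeLinearEquiv (Fin n) (Fin n) k k).toLinearMap := by
  ext G
  have h : quadValue k (fun a => MulOpposite.op (x a)) G =
      MulOpposite.op (quadValue k x G.transpose) := by
    simp only [quadValue, LinearMap.coe_mk, AddHom.coe_mk, Finset.op_sum,
      MulOpposite.op_smul, MulOpposite.op_mul, Matrix.transpose_apply]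
    exact Finset.sum_comm
  rw [quadRel, LinearMap.mem_ker, h, MulOpposite.op_eq_zero_iff]
  rfl

end Resolutions

/-! ### Points of a quadratic algebra and of its quotient -/

section PointScheme

variable {k : Type*} [Field k] {n : ℕ} {A : Type*} [Ring A] [Algebra k A] {x : Fin n → A}

theorem RightLinearResolution.mem_X_iff (hx : IsQuadratic k x) (P : RightLinearResolution k x)
    (p : ℙ k (Fin n → k)) : p ∈ P.X ↔ ∃ q, (q, p) ∈ biZero (quadRel k x) := by
  obtain ⟨θ, hθ⟩ := hx.exists_augmentation
  exact (P.linearPresentation ⟨0, by simp [P.s_zero]⟩).mem_X_iff hθ p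

theorem RightLinearResolution.unique_fst (hx : IsQuadratic k x) (P : RightLinearResolution k x)
    (hP : P.PointExactAtSucc 0) {p q q' : ℙ k (Fin n → k)}
    (hq : (q, p) ∈ biZero (quadRel k x)) (hq' : (q', p) ∈ biZero (quadRel k x)) : q = q' := by
  obtain ⟨θ, hθ⟩ := hx.exists_augmentation
  refine (P.linearPresentation ⟨0, by simp [P.s_zero]⟩).unique_of_rank hθ ?_ hq hq'
  have h1 : ((P.d 0).at p).rank + ((P.d 1).at p).rank = P.s 1 :=
    hP p ((P.mem_X_iff hx p).2 ⟨q, hq⟩)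
  have h2 := ((P.d 0).at p).rank_le_height
  have h3 := P.s_zero
  change P.s 1 ≤ ((P.d 1).at p).rank + 1
  omega

theorem LeftLinearResolution.mem_X_iff (hx : IsQuadratic k x) (Q : LeftLinearResolution k x)
    (p : ℙ k (Fin n → k)) : p ∈ Q.X ↔ ∃ q, (p, q) ∈ biZero (quadRel k x) := by
  obtain ⟨θ, hθ⟩ := hx.exists_augmentation
  have h := (Q.linearPresentation ⟨0, by simp [Q.s_zero]⟩).mem_X_iff
    (θ := AlgHom.fromOpposite θ fun _ _ => Commute.all _ _) (fun a => hθ a) p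
  rw [LinMat.transpose_X, quadRel_op] at h
  exact h.trans (exists_congr fun q => swap_mem_biZero_transpose)

theorem LeftLinearResolution.unique_snd (hx : IsQuadratic k x) (Q : LeftLinearResolution k x)
    (hQ : Q.PointExactAtSucc 0) {p q q' : ℙ k (Fin n → k)}
    (hq : (p, q) ∈ biZero (quadRel k x)) (hq' : (p, q') ∈ biZero (quadRel k x)) : q = q' := by
  obtain ⟨θ, hθ⟩ := hx.exists_augmentation
  refine (Q.linearPresentation ⟨0, by simp [Q.s_zero]⟩).unique_of_rank
    (θ := AlgHom.fromOpposite θ fun _ _ => Commute.all _ _) (fun a => hθ a) (p := p) ?_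
    (by rwa [quadRel_op, swap_mem_biZero_transpose])
    (by rwa [quadRel_op, swap_mem_biZero_transpose])
  have h1 : ((Q.h 0).at p).rank + ((Q.h 1).at p).rank = Q.s 1 :=
    hQ p ((Q.mem_X_iff hx p).2 ⟨q, hq⟩)
  have h2 := ((Q.h 0).at p).rank_le_width
  have h3 : (LinMat.at (n := n) (Matrix.transpose (Q.h 1)) p).rank = ((Q.h 1).at p).rank :=
    Matrix.rank_transpose ((Q.h 1).at p)
  have h4 := Q.s_zero
  rw [h3]
  change Q.s 1 ≤ ((Q.h 1).at p).rank + 1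
  omega

/-- A one-to-one relation whose two projections are the same set is the graph of a bijection. -/
lemma exists_equiv_of_biunique {α : Type*} {E : Set α} {Z : Set (α × α)}
    (hfst : ∀ p, p ∈ E ↔ ∃ q, (p, q) ∈ Z) (hsnd : ∀ q, q ∈ E ↔ ∃ p, (p, q) ∈ Z)
    (hl : ∀ {p p' q}, (p, q) ∈ Z → (p', q) ∈ Z → p = p')
    (hr : ∀ {p q q'}, (p, q) ∈ Z → (p, q') ∈ Z → q = q') :
    ∃ σ : E ≃ E, ∀ p q, (p, q) ∈ Z ↔ ∃ hp : p ∈ E, q = (σ ⟨p, hp⟩).1 := by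
  choose s hs using fun p : E => (hfst p).1 p.2
  choose t ht using fun q : E => (hsnd q).1 q.2
  refine ⟨⟨fun p => ⟨s p, (hsnd _).2 ⟨p, hs p⟩⟩, fun q => ⟨t q, (hfst _).2 ⟨q, ht q⟩⟩,
    fun p => Subtype.ext (hl (ht _) (hs p)), fun q => Subtype.ext (hr (hs _) (ht q))⟩,
    fun p q => ⟨fun h => ⟨(hfst p).2 ⟨q, h⟩, hr h (hs ⟨p, _⟩)⟩, ?_⟩⟩
  rintro ⟨hp, rfl⟩
  exact hs ⟨p, hp⟩

/-- A zero `(p, q)` of the relations of `A` and of `F` defines a representation of `A` which kills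
`f`; hence every quadratic relation of `A/(f)`, and not only the combinations of `F` and the
relations of `A`, vanishes at `(p, q)`. -/
theorem mem_biZero_quadRel_quotMk (hx : IsQuadratic k x) (F : Matrix (Fin n) (Fin n) k)
    {p q : ℙ k (Fin n → k)} :
    (p, q) ∈ biZero (quadRel k fun a => quotMk (quadValue k x F) (x a)) ↔
      (p, q) ∈ biZero (quadRel k x) ∧ p.rep ⬝ᵥ F.mulVec q.rep = 0 := by
  simp only [mem_biZero]
  constructor
  · refine fun h => ⟨fun G hG => h G (quadRel_le_quadRel_quotMk _ hG), h F ?_⟩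
    rw [mem_quadRel_quotMk]
    exact TwoSidedIdeal.subset_span rfl
  · rintro ⟨h, hF⟩ G hG
    obtain ⟨φ, hφ⟩ := hx.exists_pathRep p.rep q.rep 0 h fun G _ => by simp
    have hval : ∀ H, φ (quadValue k x H) 0 2 = p.rep ⬝ᵥ H.mulVec q.rep := fun H => by
      simp [map_quadValue, hφ, quadValue_pathMatrix]
    have hle : TwoSidedIdeal.span {quadValue k x F} ≤ TwoSidedIdeal.ker φ := by
      rw [TwoSidedIdeal.span_le, Set.singleton_subset_iff, SetLike.mem_coe, TwoSidedIdeal.mem_ker,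
        map_quadValue]
      simp only [hφ]
      rw [quadValue_pathMatrix, hF]
      ext i j
      fin_cases i <;> fin_cases j <;> simp
    have h0 := (TwoSidedIdeal.mem_ker _).1 (hle ((mem_quadRel_quotMk _ G).1 hG))
    rw [← hval, h0]
    rfl

/-- On the truncated point module of `p, q, r`, the relation `x_a f = f b` reads
`p_a F(q, r) = F(p, q) b_{23}`, and `f x_a = b f` reads `F(p, q) r_a = b_{01} F(q, r)`. -/
theorem eval_eq_zero_iff_of_isNormalElt (hx : IsQuadratic k x) {F : Matrix (Fin n) (Fin n) k}
    (hF : IsNormalElt (quadValue k x F)) {p q r : ℙ k (Fin n → k)}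
    (hpq : (p, q) ∈ biZero (quadRel k x)) (hqr : (q, r) ∈ biZero (quadRel k x)) :
    p.rep ⬝ᵥ F.mulVec q.rep = 0 ↔ q.rep ⬝ᵥ F.mulVec r.rep = 0 := by
  obtain ⟨φ, hφ⟩ := hx.exists_pathRep p.rep q.rep r.rep (mem_biZero.1 hpq) (mem_biZero.1 hqr)
  have hf : φ (quadValue k x F) = !![0, 0, p.rep ⬝ᵥ F.mulVec q.rep, 0;
      0, 0, 0, q.rep ⬝ᵥ F.mulVec r.rep; 0, 0, 0, 0; 0, 0, 0, 0] := by
    simp only [map_quadValue, hφ]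
    exact quadValue_pathMatrix _ _ _ F
  constructor
  · intro h
    obtain ⟨a, ha⟩ : ∃ a, p.rep a ≠ 0 := Function.ne_iff.1 p.rep_nonzero
    obtain ⟨b, hb⟩ : x a * quadValue k x F ∈ Set.range fun b => quadValue k x F * b :=
      hF ▸ ⟨x a, rfl⟩
    have h3 := congrFun (congrFun (congrArg φ hb) 0) 3
    simp only [map_mul, hf, hφ, h] at h3
    simp [pathMatrix, Matrix.mul_apply, Fin.sum_univ_four] at h3
    tauto
  · intro h
    obtain ⟨a, ha⟩ : ∃ a, r.rep a ≠ 0 := Function.ne_iff.1 r.rep_nonzero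
    obtain ⟨b, hb⟩ : quadValue k x F * x a ∈ Set.range fun b => b * quadValue k x F :=
      hF ▸ ⟨x a, rfl⟩
    have h3 := congrFun (congrFun (congrArg φ hb) 0) 3
    simp only [map_mul, hf, hφ, h] at h3
    simp [pathMatrix, Matrix.mul_apply, Fin.sum_univ_four] at h3
    tauto

end PointScheme

end KoszulPoint

end

open KoszulPoint in
theorem proposition5p2 {k : Type*} [Field k] [IsAlgClosed k] [CharZero k] {n : ℕ}
    {A : Type*} [Ring A] [Algebra k A] (x : Fin n → A) (hA : IsQuadratic k x)
    (P : RightLinearResolution k x) (Q : LeftLinearResolution k x)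
    (hss : IsSemiStandard P Q) (hpe : IsPointExactUpTo P Q 2)
    (f : A) (hf : f ∈ degPart k x 2) (hreg : IsRegularElt f) (hnor : IsNormalElt f) :
    SatisfiesG1 k x ∧
    SatisfiesG1 k (fun a => quotMk f (x a)) ∧
    ∀ (E E_B : Set (Projectivization k (Fin n → k))) (σ : E ≃ E) (σ_B : E_B ≃ E_B),
      IsGeometricPair k x E σ →
      IsGeometricPair k (fun a => quotMk f (x a)) E_B σ_B →
      ∃ hsub : E_B ⊆ E, ∀ p : E_B, (σ_B p).1 = (σ ⟨p.1, hsub p.2⟩).1 := by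
  have hB := hA.quotient hf
  obtain ⟨F, rfl⟩ := exists_quadValue_of_mem_degPart_two hf
  obtain ⟨hP, hQ⟩ := hpe 0 two_pos
  obtain ⟨σ, hσ⟩ := exists_equiv_of_biunique (E := P.X) (Z := biZero (quadRel k x))
    (fun p => by rw [show P.X = Q.X from hss]; exact Q.mem_X_iff hA p) (fun q => P.mem_X_iff hA q)
    (P.unique_fst hA hP) (Q.unique_snd hA hQ)
  have hgraph : ∀ p : P.X, (p.1, (σ p).1) ∈ biZero (quadRel k x) :=
    fun p => (hσ _ _).2 ⟨p.2, rfl⟩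
  have hstep : ∀ p : P.X, p.1.rep ⬝ᵥ F.mulVec (σ p).1.rep = 0 ↔
      (σ p).1.rep ⬝ᵥ F.mulVec (σ (σ p)).1.rep = 0 := fun p =>
    eval_eq_zero_iff_of_isNormalElt hA hnor (hgraph p) (hgraph (σ p))
  refine ⟨⟨hA, P.X, σ, isGeometricPair_of_biZero_eq hσ⟩, ⟨hB, ?_⟩, ?_⟩
  -- `Y` is `E_B` as a subset of `E`; it is `σ`-stable by `hstep`.
  · let Y : Set P.X := {p | p.1.rep ⬝ᵥ F.mulVec (σ p).1.rep = 0}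
    let τ : (Subtype.val '' Y) ≃ (Subtype.val '' Y) :=
      (Equiv.Set.image _ Y Subtype.val_injective).symm.trans
        ((σ.subtypeEquiv fun p => hstep p).trans (Equiv.Set.image _ Y Subtype.val_injective))
    refine ⟨_, τ, isGeometricPair_of_biZero_eq fun p q => ?_⟩
    rw [mem_biZero_quadRel_quotMk hA, hσ]
    have hτ : ∀ (y : P.X) (hy : y ∈ Y), (τ ⟨y.1, y, hy, rfl⟩).1 = (σ y).1 := fun y hy => by
      have : (Equiv.Set.image _ Y Subtype.val_injective).symm ⟨y.1, y, hy, rfl⟩ = ⟨y, hy⟩ := by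
        rw [Equiv.symm_apply_eq]
        rfl
      simp only [τ, Equiv.trans_apply, this]
      rfl
    constructor
    · rintro ⟨⟨hp, rfl⟩, h⟩
      exact ⟨⟨⟨p, hp⟩, h, rfl⟩, (hτ ⟨p, hp⟩ h).symm⟩
    · rintro ⟨⟨y, hy, rfl⟩, rfl⟩
      rw [hτ y hy]
      exact ⟨⟨y.2, rfl⟩, hy⟩
  · rintro E E_B σ' σ_B ⟨-, -, -, h⟩ ⟨-, -, -, h_B⟩
    have key : ∀ p : E_B, ∃ hp : p.1 ∈ E, (σ_B p).1 = (σ' ⟨p.1, hp⟩).1 := fun p => by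
      have h1 : (p.1, (σ_B p).1) ∈ biZero (quadRel k x) :=
        ((mem_biZero_quadRel_quotMk hA F).1 (h_B ▸ ⟨p, rfl⟩)).1
      rw [h] at h1
      obtain ⟨e, he⟩ := h1
      obtain ⟨he1, he2⟩ := Prod.mk.inj he
      have hp : p.1 ∈ E := he1 ▸ e.2
      have he3 : e = ⟨p.1, hp⟩ := Subtype.ext he1
      exact ⟨hp, by rw [← he2, he3]⟩
    exact ⟨fun p hp => (key ⟨p, hp⟩).1, fun p => (key p).2⟩
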